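/- For each $n\ge 0$ let $\mathcal A_n$ and $\mathcal B_n$ be collections of labeled simple graphs on the vertex set $[n]=\{1,\dots,n\}$. Suppose that both families are hereditary: if $G\in\mathcal A_n$ and $H$ is a spanning subgraph of $G$ (same vertex set $[n]$, $E(H)\subseteq E(G)$), then $H\in\mathcal A_n$, and likewise for $\mathcal B_n$. Suppose also that the membership problems "given $n$ and a labeled graph $G$ on $[n]$, is $G\in\mathcal A_n$?" and "is $G\in\mathcal B_n$?" are in the complexity class $\mathsf{P}$. Then the sequence $$ f(n)\,=\,2^{\binom n2}\cdot|\mathcal A_n\cap\mathcal B_n|\,-\,|\mathcal A_n|\cdot|\mathcal B_n| $$ takes values in $\mathbb N=\{0,1,2,\dots\}$ and, with the input $n$ given in unary, is in the complexity class $\mathsf{\#P}$: there are a polynomial $q$ and a polynomial-time Turing machine $M$ with $M(x,w)\in\{0,1\}$ for all $x,w\in\{0,1\}^*$, such that $f(n)=\bigl|\{w\in\{0,1\}^{q(n)}: M(1^n,w)=1\}\bigr|$ for all $n\ge 0$, while $M(x,w)=0$ whenever $x$ is not of the form $1^n$ and $|w|=q(|x|)$. -/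

import Mathlib

namespace CountingComplexity

open Computability Turing

/-- A set `S` of objects, presented to a machine through the encoding `enc` over a finite alphabet,
is decidable in polynomial time: some multi-stack Turing machine with finitely many states, on input
`enc a`, outputs the truth value of `a ∈ S` within a number of steps that is bounded by a polynomial
in the length of `enc a`. -/
def PolyTimeDecidable {α Γ : Type} (enc : α → List Γ) (S : Set α) : Prop :=
  ∃ g : α → Bool, (∀ a, g a = true ↔ a ∈ S) ∧
    Nonempty (TM2ComputableInPolyTime enc encodeBool g)

/-- The complexity class `P` of languages over `{0,1}`. -/
def ClassP : Set (Language Bool) :=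
  {L | PolyTimeDecidable (fun x : List Bool => x) {x | x ∈ L}}

/-- The encoding of a pair `(x, w)` of bit strings: `x` written in one copy of `{0,1}`, followed by
`w` written in a second, disjoint copy of `{0,1}`. -/
def encodePair (p : List Bool × List Bool) : List (Bool ⊕ Bool) :=
  (encodingProd (encodingList Bool) (encodingList Bool)).encode p

/-- The complexity class `#P`: the functions `f : {0,1}* → ℕ` for which there are a polynomial `q`
and a polynomial time verifier `V` such that `f x` is the number of the witnesses `w` of length
exactly `q |x|` that `V` accepts for `x`. -/
def SharpP : Set (List Bool → ℕ) :=
  {f | ∃ (q : Polynomial ℕ) (V : Set (List Bool × List Bool)),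
    PolyTimeDecidable encodePair V ∧
    ∀ x, f x = {w : List Bool | w.length = q.eval x.length ∧ (x, w) ∈ V}.ncard}

/-- A sequence `a 0, a 1, a 2, …` of natural numbers is in `#P`, with the index given in unary: the
function that maps the string `1ⁿ` to `a n`, and every other string to `0`, is in `#P`. -/
def SequenceInSharpP (a : ℕ → ℕ) : Prop :=
  Function.extend unaryEncodeNat a 0 ∈ SharpP

/-- A family that gives, for every `n`, a collection of labeled (simple) graphs on `n` vertices. -/
abbrev GraphFamily : Type := ∀ n : ℕ, Set (SimpleGraph (Fin n))

/-- `A` is hereditary: with a graph it contains all the spanning subgraphs of that graph. -/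
def IsHereditary (A : GraphFamily) : Prop :=
  ∀ (n : ℕ) (G H : SimpleGraph (Fin n)), G ∈ A n → H ≤ G → H ∈ A n

open Classical in
/-- The part of the adjacency matrix above the diagonal, read column by column: the bits of the
pairs `(0,1), (0,2), (1,2), (0,3), (1,3), (2,3), …`. -/
noncomputable def edgeBits {n : ℕ} (G : SimpleGraph (Fin n)) : List Bool :=
  (List.ofFn fun j : Fin n =>
    List.ofFn fun i : Fin (j : ℕ) => decide (G.Adj (Fin.castLE j.isLt.le i) j)).flatten

/-- The encoding of a labeled graph as a bit string: the number `n` of vertices in unary, a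
separator `0`, then the `n(n-1)/2` adjacency bits. -/
noncomputable def encodeGraph {n : ℕ} (G : SimpleGraph (Fin n)) : List Bool :=
  unaryEncodeNat n ++ false :: edgeBits G

/-- The membership problem `G ∈ A`, as a language. -/
def membershipProblem (A : GraphFamily) : Language Bool :=
  {x | ∃ (n : ℕ) (G : SimpleGraph (Fin n)), G ∈ A n ∧ x = encodeGraph G}

end CountingComplexity

/-! Identify graphs on `n` vertices with bit strings of length N = `n.choose 2`; hereditary families
become down-sets. For down-sets A, B of strings let D(A, B) = 2^N |A ∩ B| - |A| |B|. Splitting by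
the first bit into A₀ ⊇ A₁ and B₀ ⊇ B₁ gives D(A, B) = 2 D(A₀, B₀) + 2 D(A₁, B₁) + |A₀ \ A₁| |B₀ \
B₁|. Unfolding this recursion turns the inductive proof of the Harris–Kleitman inequality into a
count. A witness chooses a common prefix with one free bit per position (the factors 2), a marked
position, and two independent suffixes, such that each graph lies in its family with the marked edge
absent and leaves it with the edge present (`wordCount_markedWitnesses`).

Checking a witness means checking its shape by a finite automaton and asking four membership
questions. Each question is about a string that a finite-state transducer extracts from the input.
Hence it suffices that polynomial-time decidability is preserved by running two machines on two
outputs of a transducer (`PolyTimeDecidable.transduce`). Applied twice, this gives the four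
questions and `defect_mem_sharpP`. -/

namespace CountingComplexity

open Computability Turing StateTransition

/-! ### Finite-state transducers -/

section Transducer

variable {S Γ Δ : Type*} (step : S → Γ → S) (s₀ : S) (emit : S → Γ → Option Δ)

/-- The state of a finite-state transducer that has read a word from right to left. -/
def transState (l : List Γ) : S := l.foldr (fun c s => step s c) s₀

/-- The output of a finite-state transducer that reads a word from right to left. -/
def transOut : List Γ → List Δ
  | [] => []
  | c :: l => (emit (transState step s₀ l) c).toList ++ transOut l

@[simp] theorem transState_nil : transState step s₀ [] = s₀ := rfl

@[simp] theorem transState_cons (c : Γ) (l : List Γ) :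
    transState step s₀ (c :: l) = step (transState step s₀ l) c := rfl

@[simp] theorem transOut_nil : transOut step s₀ emit [] = [] := rfl

@[simp] theorem transOut_cons (c : Γ) (l : List Γ) :
    transOut step s₀ emit (c :: l) =
      (emit (transState step s₀ l) c).toList ++ transOut step s₀ emit l := rfl

/-- At most one symbol is emitted per letter. Time bounds in the length of the output thus become
bounds in the length of the input. -/
theorem length_transOut_le (l : List Γ) : (transOut step s₀ emit l).length ≤ l.length := by
  induction l with
  | nil => simp
  | cons c l ih =>
    have : (emit (transState step s₀ l) c).toList.length ≤ 1 := by
      cases emit (transState step s₀ l) c <;> simp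
    simp only [transOut_cons, List.length_append, List.length_cons]
    omega

end Transducer

/-! ### A Turing machine running two machines on the outputs of a transducer -/

theorem initList_eq (tm : FinTM2) (s : List (tm.Γ tm.k₀)) :
    initList tm s = ⟨some tm.main, tm.initialState,
      Function.update (fun _ => []) tm.k₀ s⟩ := by
  unfold initList
  congr 1
  funext k
  by_cases h : k = tm.k₀
  · subst h; simp
  · simp [h]

theorem haltList_eq (tm : FinTM2) (s : List (tm.Γ tm.k₁)) :
    haltList tm s = ⟨none, tm.initialState,
      Function.update (fun _ => []) tm.k₁ s⟩ := by
  unfold haltList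
  congr 1
  funext k
  by_cases h : k = tm.k₁
  · subst h; simp
  · simp [h]

namespace Tandem

variable (tm : Bool → FinTM2) (S Γ : Type)

/-- The stacks of the tandem machine: an input stack and a stack for the reversed input,
an output stack, and the stacks of the two given machines. -/
abbrev Stk : Type := Bool ⊕ Unit ⊕ (Σ i, (tm i).K)

/-- The alphabets of the stacks of the tandem machine. -/
abbrev Alph : Stk tm → Type
  | .inl _ => Γ
  | .inr (.inl _) => Bool
  | .inr (.inr p) => (tm p.1).Γ p.2

/-- The labels of the tandem machine. -/
inductive Label : Type
  | read
  | emit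
  | inner (i : Bool) (l : (tm i).Λ)
  | collect (i : Bool)

/-- The internal states of the tandem machine. -/
@[ext] structure Vars : Type where
  s : S
  sym : Option Γ
  var : ∀ i, (tm i).σ
  res : Bool → Bool

instance : Finite (Label tm) := by
  have := fun i => (tm i).ΛFin
  let F : Label tm → Bool ⊕ Bool ⊕ (Σ i, (tm i).Λ)
    | .read => .inl false
    | .emit => .inl true
    | .inner i l => .inr (.inr ⟨i, l⟩)
    | .collect i => .inr (.inl i)
  refine Finite.of_injective F ?_
  rintro (_ | _ | _ | _) (_ | _ | _ | _) h <;> simp_all [F]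

instance [Finite S] [Finite Γ] : Finite (Vars tm S Γ) := by
  have := fun i => (tm i).σFin
  refine Finite.of_injective (fun v : Vars tm S Γ => (v.s, v.sym, v.var, v.res)) ?_
  intro a b h
  simp only [Prod.mk.injEq] at h
  exact Vars.ext h.1 h.2.1 h.2.2.1 h.2.2.2

variable {tm S Γ}

/-- The stacks of the tandem machine, assembled. -/
def mkStk (inp buf : List Γ) (out : List Bool) (F : ∀ i k, List ((tm i).Γ k)) :
    ∀ k, List (Alph tm Γ k)
  | .inl false => inp
  | .inl true => buf
  | .inr (.inl _) => out
  | .inr (.inr p) => F p.1 p.2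

section mkStk
variable (inp buf : List Γ) (out : List Bool) (F : ∀ i k, List ((tm i).Γ k))

theorem update_inp (x : List Γ) :
    Function.update (mkStk inp buf out F) (.inl false) x = mkStk x buf out F := by
  funext k
  rcases k with (_ | _) | _ | _ <;> simp [mkStk, Function.update]

theorem update_buf (x : List Γ) :
    Function.update (mkStk inp buf out F) (.inl true) x = mkStk inp x out F := by
  funext k
  rcases k with (_ | _) | _ | _ <;> simp [mkStk, Function.update]

theorem update_out (x : List Bool) :
    Function.update (mkStk inp buf out F) (.inr (.inl ())) x = mkStk inp buf x F := by
  funext k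
  rcases k with (_ | _) | _ | _ <;> simp [mkStk, Function.update]

theorem update_inner (i : Bool) (k : (tm i).K) (x : List ((tm i).Γ k)) :
    Function.update (mkStk inp buf out F) (.inr (.inr ⟨i, k⟩)) x =
      mkStk inp buf out (Function.update F i (Function.update (F i) k x)) := by
  funext k'
  rcases k' with (_ | _) | _ | ⟨j, k'⟩
  · simp [mkStk]
  · simp [mkStk]
  · simp [mkStk]
  · by_cases hj : j = i
    · subst hj
      by_cases hk : k' = k
      · subst hk; simp [mkStk]
      · have : (Sum.inr (Sum.inr ⟨j, k'⟩) : Stk tm) ≠ .inr (.inr ⟨j, k⟩) := by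
          simpa using hk
        simp [mkStk, hk]
    · have : (Sum.inr (Sum.inr ⟨j, k'⟩) : Stk tm) ≠ .inr (.inr ⟨i, k⟩) := by
        intro h; simp only [Sum.inr.injEq, Sigma.mk.injEq] at h; exact hj h.1
      simp [mkStk, hj]

theorem mkStk_nil : mkStk (tm := tm) ([] : List Γ) [] [] (fun _ _ => []) = fun _ => [] := by
  funext k
  rcases k with (_ | _) | _ | _ <;> rfl

end mkStk

/-- A statement of one of the two given machines, as a statement of the tandem machine. -/
def lift (i : Bool) :
    TM2.Stmt (tm i).Γ (tm i).Λ (tm i).σ → TM2.Stmt (Alph tm Γ) (Label tm) (Vars tm S Γ)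
  | .push k f q => .push (.inr (.inr ⟨i, k⟩)) (fun v => f (v.var i)) (lift i q)
  | .peek k f q => .peek (.inr (.inr ⟨i, k⟩))
      (fun v a => { v with var := Function.update v.var i (f (v.var i) a) }) (lift i q)
  | .pop k f q => .pop (.inr (.inr ⟨i, k⟩))
      (fun v a => { v with var := Function.update v.var i (f (v.var i) a) }) (lift i q)
  | .load f q =>
      .load (fun v => { v with var := Function.update v.var i (f (v.var i)) }) (lift i q)
  | .branch f q₁ q₂ => .branch (fun v => f (v.var i)) (lift i q₁) (lift i q₂)
  | .goto f => .goto fun v => .inner i (f (v.var i))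
  -- Halting is replaced by a jump within the same step, so simulated and original runs have the
  -- same number of steps.
  | .halt => .goto fun _ => .collect i

variable (S Γ) in
/-- The configurations of the tandem machine while one of the two given machines is running. -/
def embed (i : Bool) (v : Vars tm S Γ) (inp buf : List Γ) (out : List Bool)
    (F : ∀ i k, List ((tm i).Γ k)) (c : TM2.Cfg (tm i).Γ (tm i).Λ (tm i).σ) :
    TM2.Cfg (Alph tm Γ) (Label tm) (Vars tm S Γ) where
  l := some (match c.l with
    | none => .collect i
    | some l => .inner i l)
  var := { v with var := Function.update v.var i c.var }
  stk := mkStk inp buf out (Function.update F i c.stk)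

theorem stepAux_lift (i : Bool) (v : Vars tm S Γ) (inp buf : List Γ) (out : List Bool)
    (F : ∀ i k, List ((tm i).Γ k)) (q : TM2.Stmt (tm i).Γ (tm i).Λ (tm i).σ) (x : (tm i).σ)
    (T : ∀ k, List ((tm i).Γ k)) :
    TM2.stepAux (lift i q) { v with var := Function.update v.var i x }
        (mkStk inp buf out (Function.update F i T)) =
      embed S Γ i v inp buf out F (TM2.stepAux q x T) := by
  induction q generalizing x T with
  | push k f q ih =>
    simp only [lift, TM2.stepAux, update_inner, Function.update_idem, Function.update_self]
    rw [← ih]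
    simp [mkStk]
  | peek k f q ih =>
    simp only [lift, TM2.stepAux, Function.update_idem, Function.update_self]
    rw [← ih]
    simp [mkStk]
  | pop k f q ih =>
    simp only [lift, TM2.stepAux, update_inner, Function.update_idem, Function.update_self]
    rw [← ih]
    simp [mkStk]
  | load f q ih =>
    simp only [lift, TM2.stepAux, Function.update_idem, Function.update_self]
    rw [← ih]
  | branch f q₁ q₂ ih₁ ih₂ =>
    simp only [lift, TM2.stepAux, Function.update_self]
    cases f x
    · exact ih₂ x T
    · exact ih₁ x T
  | goto f => simp [lift, embed]
  | halt => simp [lift, embed]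

variable (step : S → Γ → S) (s₀ : S) (emit : ∀ i, S → Γ → Option ((tm i).Γ (tm i).k₀))
  (rd : ∀ i, (tm i).Γ (tm i).k₁ → Bool) (acc : S → (Bool → Bool) → Bool)
  [Inhabited Γ] [∀ i, Inhabited ((tm i).Γ (tm i).k₀)]

/-- The initial internal state of the tandem machine. -/
def start : Vars tm S Γ := ⟨s₀, none, fun i => (tm i).initialState, fun _ => false⟩

/-- Push the symbol (if any) that the transducer emits on channel `i`. -/
def pushEmit (i : Bool) (q : TM2.Stmt (Alph tm Γ) (Label tm) (Vars tm S Γ)) :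
    TM2.Stmt (Alph tm Γ) (Label tm) (Vars tm S Γ) :=
  .branch (fun v => (emit i v.s (v.sym.getD default)).isSome)
    (.push (.inr (.inr ⟨i, (tm i).k₀⟩))
      (fun v => (emit i v.s (v.sym.getD default)).getD default) q) q

/-- The program of the tandem machine. -/
def program : Label tm → TM2.Stmt (Alph tm Γ) (Label tm) (Vars tm S Γ)
  -- Reversing the input into the buffer exposes its last letter first. Emitting from right to left
  -- onto stacks then leaves both outputs in the correct order, first letter on top.
  | .read => .pop (.inl false) (fun v a => { v with sym := a }) <|
      .branch (fun v => v.sym.isSome)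
        (.push (.inl true) (fun v => v.sym.getD default) (.goto fun _ => .read))
        (.goto fun _ => .emit)
  | .emit => .pop (.inl true) (fun v a => { v with sym := a }) <|
      .branch (fun v => v.sym.isSome)
        (pushEmit emit false <| pushEmit emit true <|
          -- Clearing `sym` makes the internal state again of the form `start s`, which is the loop
          -- invariant.
          .load (fun v => { v with s := step v.s (v.sym.getD default), sym := none }) <|
          .goto fun _ => .emit)
        (.goto fun _ => .inner false (tm false).main)
  | .inner i l => lift i ((tm i).m l)
  | .collect false => .pop (.inr (.inr ⟨false, (tm false).k₁⟩))
      (fun v a => { v with res := Function.update v.res false (a.elim false (rd false)) }) <|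
      .goto fun _ => .inner true (tm true).main
  | .collect true => .pop (.inr (.inr ⟨true, (tm true).k₁⟩))
      (fun v a => { v with res := Function.update v.res true (a.elim false (rd true)) }) <|
      .push (.inr (.inl ())) (fun v => acc v.s v.res) <|
      -- A halting configuration must carry the initial internal state.
      .load (fun _ => start s₀) .halt

/-- The machine that runs a transducer with two output channels from right to left over the input,
runs the two given machines on the two outputs, and combines the answers. -/
noncomputable def machine [Finite S] [Fintype Γ] : FinTM2 :=
  haveI := fun i => (tm i).kFin
  { K := Stk tm
    k₀ := .inl false
    k₁ := .inr (.inl ())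
    Γ := Alph tm Γ
    Λ := Label tm
    main := .read
    ΛFin := Fintype.ofFinite _
    σ := Vars tm S Γ
    initialState := start s₀
    σFin := Fintype.ofFinite _
    Γk₀Fin := inferInstanceAs (Fintype Γ)
    m := program step s₀ emit rd acc }

theorem step_embed (i : Bool) (v : Vars tm S Γ) (inp buf : List Γ) (out : List Bool)
    (F : ∀ i k, List ((tm i).Γ k)) (c c' : TM2.Cfg (tm i).Γ (tm i).Λ (tm i).σ)
    (h : TM2.step (tm i).m c = some c') :
    TM2.step (program step s₀ emit rd acc) (embed S Γ i v inp buf out F c) =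
      some (embed S Γ i v inp buf out F c') := by
  obtain ⟨_ | l, x, T⟩ := c
  · simp at h
  · simp only [TM2.step, Option.some.injEq] at h
    rw [← h]
    exact congrArg some (stepAux_lift i v inp buf out F ((tm i).m l) x T)

theorem iterate_bind_none {σ : Type*} (f : σ → Option σ) (n : ℕ) :
    (flip bind f)^[n] none = none := by
  induction n with
  | zero => rfl
  | succ n ih => rw [Function.iterate_succ_apply]; exact ih

theorem iterate_embed (i : Bool) (v : Vars tm S Γ) (inp buf : List Γ) (out : List Bool)
    (F : ∀ i k, List ((tm i).Γ k)) (n : ℕ) (c c' : TM2.Cfg (tm i).Γ (tm i).Λ (tm i).σ)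
    (h : (flip bind (TM2.step (tm i).m))^[n] (some c) = some c') :
    (flip bind (TM2.step (program step s₀ emit rd acc)))^[n]
        (some (embed S Γ i v inp buf out F c)) =
      some (embed S Γ i v inp buf out F c') := by
  induction n generalizing c with
  | zero =>
    simp only [Function.iterate_zero, id, Option.some.injEq] at h ⊢
    rw [h]
  | succ n ih =>
    rw [Function.iterate_succ_apply] at h ⊢
    change (flip bind (TM2.step (tm i).m))^[n] (TM2.step (tm i).m c) = _ at h
    cases hc : TM2.step (tm i).m c with
    | none => rw [hc, iterate_bind_none] at h; cases h
    | some d =>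
      rw [hc] at h
      have := step_embed step s₀ emit rd acc i v inp buf out F c d hc
      change (flip bind (TM2.step (program step s₀ emit rd acc)))^[n]
        (TM2.step (program step s₀ emit rd acc) (embed S Γ i v inp buf out F c)) = _
      rw [this]
      exact ih d h

theorem evalsTo_embed (i : Bool) (v : Vars tm S Γ) (inp buf : List Γ) (out : List Bool)
    (F : ∀ i k, List ((tm i).Γ k)) (n : ℕ) (c c' : TM2.Cfg (tm i).Γ (tm i).Λ (tm i).σ)
    (h : EvalsToInTime (TM2.step (tm i).m) c (some c') n) :
    Nonempty (EvalsToInTime (TM2.step (program step s₀ emit rd acc))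
      (embed S Γ i v inp buf out F c)
      (some (embed S Γ i v inp buf out F c')) n) :=
  ⟨⟨⟨h.steps, iterate_embed step s₀ emit rd acc i v inp buf out F _ _ _ h.evals_in_steps⟩,
    h.steps_le_m⟩⟩

theorem evalsTo_of_step {σ : Type*} {f : σ → Option σ} {a b : σ} {c : Option σ} {n : ℕ}
    (h : f a = some b) (h' : Nonempty (EvalsToInTime f b c n)) :
    Nonempty (EvalsToInTime f a c (n + 1)) :=
  h'.map fun h' => EvalsToInTime.trans f 1 n a b c ⟨⟨1, h⟩, le_rfl⟩ h'

theorem evalsTo_read (l buf : List Γ) (v : Vars tm S Γ) (F : ∀ i k, List ((tm i).Γ k)) {c}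
    {n : ℕ} (h : Nonempty (EvalsToInTime (TM2.step (program step s₀ emit rd acc))
      ⟨some .emit, { v with sym := none }, mkStk [] (l.reverse ++ buf) [] F⟩ c n)) :
    Nonempty (EvalsToInTime (TM2.step (program step s₀ emit rd acc))
      ⟨some .read, v, mkStk l buf [] F⟩ c (n + l.length + 1)) := by
  induction l generalizing buf v with
  | nil =>
    refine evalsTo_of_step ?_ h
    simp only [TM2.step, program, TM2.stepAux, update_inp]
    simp [mkStk]
  | cons a l ih =>
    refine evalsTo_of_step (b := ⟨some .read, { v with sym := some a }, mkStk l (a :: buf) [] F⟩)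
      ?_ ?_
    · simp only [TM2.step, program, TM2.stepAux, update_inp, update_buf]
      simp [mkStk]
    · exact ih (a :: buf) { v with sym := some a } (by simpa using h)

/-- The stacks of the two given machines when the transducer has read the word `l`. -/
def inputs (l : List Γ) : ∀ i k, List ((tm i).Γ k) := fun i =>
  Function.update (fun _ => []) (tm i).k₀ (transOut step s₀ (emit i) l)

theorem stepAux_pushEmit (i : Bool) (q : TM2.Stmt (Alph tm Γ) (Label tm) (Vars tm S Γ))
    (v : Vars tm S Γ) (inp buf : List Γ) (out : List Bool) (F : ∀ i k, List ((tm i).Γ k)) :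
    TM2.stepAux (pushEmit emit i q) v (mkStk inp buf out F) =
      TM2.stepAux q v (mkStk inp buf out (Function.update F i (Function.update (F i) (tm i).k₀
        ((emit i v.s (v.sym.getD default)).toList ++ F i (tm i).k₀)))) := by
  simp only [pushEmit, TM2.stepAux, update_inner]
  cases emit i v.s (v.sym.getD default) <;> simp [mkStk]

/-- Loop invariant: `l` is the suffix already read, its outputs lie on the two input stacks, and `r`
is the unread part in reverse. Each round moves one letter from `r` to the front of `l`. -/
theorem evalsTo_emit (r l : List Γ) {c} {n : ℕ}
    (h : Nonempty (EvalsToInTime (TM2.step (program step s₀ emit rd acc))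
            ⟨some (.inner false (tm false).main), start (transState step s₀ (r.reverse ++ l)),
        mkStk [] [] [] (inputs step s₀ emit (r.reverse ++ l))⟩ c n)) :
    Nonempty (EvalsToInTime (TM2.step (program step s₀ emit rd acc))
      ⟨some .emit, start (transState step s₀ l),
      mkStk [] r [] (inputs step s₀ emit l)⟩ c (n + r.length + 1)) := by
  induction r generalizing l with
  | nil =>
    refine evalsTo_of_step ?_ h
    simp only [TM2.step, program, TM2.stepAux, update_buf]
    simp [mkStk, start]
  | cons a r ih =>
    refine evalsTo_of_step (b := ⟨some .emit, start (transState step s₀ (a :: l)),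
      mkStk [] r [] (inputs step s₀ emit (a :: l))⟩) ?_ (ih (a :: l) (by simpa using h))
    have hF : inputs step s₀ emit (a :: l) = Function.update (Function.update
        (inputs step s₀ emit l) false (Function.update (inputs step s₀ emit l false) (tm false).k₀
          ((emit false (transState step s₀ l) a).toList ++
            inputs step s₀ emit l false (tm false).k₀))) true
        (Function.update (inputs step s₀ emit l true) (tm true).k₀
          ((emit true (transState step s₀ l) a).toList ++
            inputs step s₀ emit l true (tm true).k₀)) := by
      funext i
      cases i <;> simp [inputs]
    simp only [TM2.step, program, TM2.stepAux, update_buf, stepAux_pushEmit, hF]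
    simp [mkStk, start]

theorem evalsTo_trans {σ : Type*} {f : σ → Option σ} {a b : σ} {c : Option σ} {m n : ℕ}
    (h : Nonempty (EvalsToInTime f a (some b) m)) (h' : Nonempty (EvalsToInTime f b c n)) :
    Nonempty (EvalsToInTime f a c (n + m)) :=
  h.elim fun h => h'.map fun h' => EvalsToInTime.trans f m n a b c h h'

/-- A halted machine has only its answer on its stacks; popping it empties them, as the halting
configuration of the tandem machine demands. -/
theorem evalsTo_collect_true (v : Vars tm S Γ) (F : ∀ i k, List ((tm i).Γ k))
    (hF : F false = fun _ => []) (r : (tm true).Γ (tm true).k₁) :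
    Nonempty (EvalsToInTime (TM2.step (program step s₀ emit rd acc))
      (embed S Γ true v [] [] [] F (haltList (tm true) [r]))
      (some ⟨none, start s₀, mkStk [] []
        [acc v.s (Function.update v.res true (rd true r))] fun _ _ => []⟩) 1) := by
  have hF' : Function.update F true (fun _ => []) = fun _ _ => [] := by
    funext i
    cases i <;> simp [hF]
  refine evalsTo_of_step (n := 0) ?_ ⟨EvalsToInTime.refl _ _⟩
  rw [haltList_eq]
  simp only [embed, TM2.step, program, TM2.stepAux, update_inner, update_out]
  simp [mkStk, hF']

theorem evalsTo_inner_true (l : List Γ) (v : Vars tm S Γ)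
    (hv : v.var = (start s₀ : Vars tm S Γ).var)
    (r : (tm true).Γ (tm true).k₁) (t : ℕ)
    (h : TM2OutputsInTime (tm true) (transOut step s₀ (emit true) l) (some [r]) t) :
    Nonempty (EvalsToInTime (TM2.step (program step s₀ emit rd acc))
      ⟨some (.inner true (tm true).main), v,
      mkStk [] [] [] (Function.update (inputs step s₀ emit l) false fun _ => [])⟩
      (some ⟨none, start s₀, mkStk [] []
        [acc v.s (Function.update v.res true (rd true r))] fun _ _ => []⟩) (1 + t)) := by
  set F := Function.update (inputs step s₀ emit l) false fun _ => [] with hF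
  have h₁ := evalsTo_embed step s₀ emit rd acc true v [] [] [] F t _ _ h
  refine evalsTo_trans ?_ (evalsTo_collect_true step s₀ emit rd acc v F (by simp [hF]) r)
  convert h₁ using 1
  rw [initList_eq]
  have hv' : Function.update v.var true (tm true).initialState = v.var := by
    rw [hv]; exact Function.update_eq_self true _
  have hF' : Function.update F true (Function.update (fun _ => []) (tm true).k₀
      (transOut step s₀ (emit true) l)) = F := by
    rw [Function.update_eq_self_iff]
    simp [hF, inputs]
  simp [embed, hv', hF']

theorem evalsTo_inner_false (l : List Γ) (s : S) (r : (tm false).Γ (tm false).k₁) (t : ℕ)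
    {c} {n : ℕ}
    (h : TM2OutputsInTime (tm false) (transOut step s₀ (emit false) l) (some [r]) t)
    (h' : Nonempty (EvalsToInTime (TM2.step (program step s₀ emit rd acc))
      ⟨some (.inner true (tm true).main),
      { (start s : Vars tm S Γ) with res := Function.update (fun _ => false) false (rd false r) },
      mkStk [] [] [] (Function.update (inputs step s₀ emit l) false fun _ => [])⟩ c n)) :
    Nonempty (EvalsToInTime (TM2.step (program step s₀ emit rd acc))
      ⟨some (.inner false (tm false).main), start s,
      mkStk [] [] [] (inputs step s₀ emit l)⟩ c (n + 1 + t)) := by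
  have h₁ := evalsTo_embed step s₀ emit rd acc false (start s) [] [] [] (inputs step s₀ emit l)
    t _ _ h
  refine evalsTo_trans (b := embed S Γ false (start s) [] [] [] (inputs step s₀ emit l)
    (haltList (tm false) [r])) ?_ (evalsTo_of_step ?_ h')
  · convert h₁ using 1
    rw [initList_eq]
    have hF' : Function.update (inputs step s₀ emit l) false (Function.update (fun _ => [])
        (tm false).k₀ (transOut step s₀ (emit false) l)) = inputs step s₀ emit l :=
      Function.update_eq_self false _
    simp [embed, hF', start]
  · rw [haltList_eq]
    simp only [embed, TM2.step, program, TM2.stepAux, update_inner]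
    simp [mkStk, start]

theorem evalsTo_program (l : List Γ) (r : ∀ i, (tm i).Γ (tm i).k₁) (t : Bool → ℕ)
    (h : ∀ i, TM2OutputsInTime (tm i) (transOut step s₀ (emit i) l) (some [r i]) (t i)) :
    Nonempty (EvalsToInTime (TM2.step (program step s₀ emit rd acc))
      ⟨some .read, start s₀, mkStk l [] [] fun _ _ => []⟩
      (some ⟨none, start s₀, mkStk [] []
        [acc (transState step s₀ l) fun i => rd i (r i)] fun _ _ => []⟩)
      (1 + t true + 1 + t false + l.length + 1 + l.length + 1)) := by
  apply evalsTo_read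
  rw [List.append_nil]
  have hF : (fun i k => [] : ∀ i k, List ((tm i).Γ k)) = inputs step s₀ emit [] := by
    funext i; simp [inputs]
  rw [hF]
  have := evalsTo_emit step s₀ emit rd acc l.reverse []
    (c := some ⟨none, start s₀, mkStk [] []
        [acc (transState step s₀ l) fun i => rd i (r i)] (inputs step s₀ emit [])⟩)
    (n := 1 + t true + 1 + t false)
  rw [List.length_reverse, List.reverse_reverse, List.append_nil] at this
  refine this (evalsTo_inner_false step s₀ emit rd acc l _ (r false) _ (h false) ?_)
  rw [← hF]
  have hr : (fun i => rd i (r i)) =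
      Function.update (Function.update (fun _ => false) false (rd false (r false))) true
        (rd true (r true)) := by
    funext i
    cases i <;> simp
  rw [hr]
  exact evalsTo_inner_true step s₀ emit rd acc l
    { (start (transState step s₀ l) : Vars tm S Γ) with
      res := Function.update (fun _ => false) false (rd false (r false)) }
    rfl (r true) _ (h true)

end Tandem

/-! ### Polynomial-time decidability under transductions -/

theorem transOut_map {S Γ Δ Δ' : Type*} (step : S → Γ → S) (s₀ : S) (emit : S → Γ → Option Δ)
    (f : Δ → Δ') (l : List Γ) :
    transOut step s₀ (fun s c => (emit s c).map f) l = (transOut step s₀ emit l).map f := by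
  induction l with
  | nil => rfl
  | cons c l ih =>
    rw [transOut_cons, transOut_cons, ih, List.map_append]
    cases emit (transState step s₀ l) c <;> rfl

theorem eval_mono_nat (p : Polynomial ℕ) {m n : ℕ} (h : m ≤ n) : p.eval m ≤ p.eval n := by
  rw [Polynomial.eval_eq_sum, Polynomial.eval_eq_sum]
  exact Finset.sum_le_sum fun i _ => Nat.mul_le_mul_left _ (Nat.pow_le_pow_left h i)

/-- If the two languages `L false` and `L true` are decidable in polynomial time, so is each
Boolean combination of the membership of the two outputs of a finite-state transducer in them,
where the combination may depend on the final state of the transducer. -/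
theorem PolyTimeDecidable.transduce {α Γ Δ S : Type} [Fintype Γ] [Inhabited Γ] [Inhabited Δ]
    [Finite S] {enc : α → List Γ} {L : Bool → Set (List Δ)}
    (hL : ∀ i, PolyTimeDecidable (fun x : List Δ => x) (L i))
    (step : S → Γ → S) (s₀ : S) (emit : Bool → S → Γ → Option Δ) (acc : S → Prop)
    (sgn : Bool → Prop) :
    PolyTimeDecidable enc {a | acc (transState step s₀ (enc a)) ∧
      ∀ i, transOut step s₀ (emit i) (enc a) ∈ L i ↔ sgn i} := by
  classical
  choose g hg M using hL
  have M := fun i => (M i).some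
  let : Fintype S := Fintype.ofFinite S
  let : ∀ i, Inhabited ((M i).tm.Γ (M i).tm.k₀) := fun i => ⟨(M i).inputAlphabet.symm default⟩
  let out := fun i a => transOut step s₀ (emit i) (enc a)
  let emit' := fun i s c => (emit i s c).map (M i).inputAlphabet.symm
  let acc' : S → (Bool → Bool) → Bool := fun s b => decide (acc s ∧ ∀ i, b i = true ↔ sgn i)
  let tm := Tandem.machine step s₀ emit' (fun i => (M i).outputAlphabet) acc'
  refine ⟨fun a => acc' (transState step s₀ (enc a)) fun i => g i (out i a), fun a => ?_, ⟨?_⟩⟩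
  · simp only [acc', decide_eq_true_eq, hg, out]; rfl
  refine { tm := tm
           inputAlphabet := Equiv.refl Γ
           outputAlphabet := Equiv.refl Bool
           -- Two passes over the input, two simulated runs, and one additional step for each of
           -- these four stages.
           time := (M false).time + (M true).time + 2 * Polynomial.X + 4
           outputsFun := fun a => ?_ }
  have key := Tandem.evalsTo_program step s₀ emit' (fun i => (M i).outputAlphabet) acc' (enc a)
    (fun i => (M i).outputAlphabet.symm (g i (out i a)))
    (fun i => (M i).time.eval (out i a).length) fun i => by
      have h := (M i).outputsFun (out i a)
      simp only [emit', transOut_map]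
      exact h
  have hin : initList tm ((enc a).map (Equiv.refl Γ).invFun) =
      ⟨some .read, Tandem.start s₀, Tandem.mkStk (enc a) [] [] fun _ _ => []⟩ := by
    have h := Tandem.update_inp (tm := fun i => (M i).tm) [] [] [] (fun _ _ => []) (enc a)
    rw [Tandem.mkStk_nil] at h
    rw [initList_eq, ← h]
    exact congrArg (fun x : List Γ => (⟨some .read, Tandem.start s₀,
      Function.update (fun _ => []) (.inl false) x⟩ : TM2.Cfg (Tandem.Alph (fun i => (M i).tm) Γ)
        (Tandem.Label fun i => (M i).tm) (Tandem.Vars (fun i => (M i).tm) S Γ)))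
      (List.map_id (enc a))
  have hout : haltList tm [acc' (transState step s₀ (enc a)) fun i => g i (out i a)] =
      ⟨none, Tandem.start s₀, Tandem.mkStk [] [] [acc' (transState step s₀ (enc a)) fun i =>
        g i (out i a)] fun _ _ => []⟩ := by
    have h := Tandem.update_out (tm := fun i => (M i).tm) ([] : List Γ) [] [] (fun _ _ => [])
      [acc' (transState step s₀ (enc a)) fun i => g i (out i a)]
    rw [Tandem.mkStk_nil] at h
    rw [haltList_eq, ← h]
    rfl
  have hle : ∀ i, (M i).time.eval (out i a).length ≤ (M i).time.eval (enc a).length := fun i =>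
    eval_mono_nat _ (length_transOut_le _ _ _ _)
  have h0 := hle false
  have h1 := hle true
  simp only [Equiv.apply_symm_apply] at key
  refine ⟨⟨key.some.steps, ?_⟩, key.some.steps_le_m.trans ?_⟩
  · have := key.some.evals_in_steps
    rw [hin]
    exact this.trans (congrArg some hout.symm)
  · simp only [Polynomial.eval_add, Polynomial.eval_mul, Polynomial.eval_X,
      Polynomial.eval_ofNat]
    omega

/-! ### Counting the words of given length in a language -/

section WordCount

variable {α : Type*}

/-- The number of the words of length `n` in the language `A`. -/
noncomputable def wordCount (n : ℕ) (A : Set (List α)) : ℕ := {l | l.length = n ∧ l ∈ A}.ncard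

theorem finite_words [Finite α] (n : ℕ) (A : Set (List α)) : {l | l.length = n ∧ l ∈ A}.Finite :=
  (List.finite_length_eq α n).subset fun _ h => h.1

theorem wordCount_congr {n : ℕ} {A B : Set (List α)} (h : ∀ l, l.length = n → (l ∈ A ↔ l ∈ B)) :
    wordCount n A = wordCount n B := by
  unfold wordCount
  congr 1
  ext l
  exact and_congr_right (h l)

theorem wordCount_eq_zero {n : ℕ} {A : Set (List α)} (h : ∀ l, l.length = n → l ∉ A) :
    wordCount n A = 0 := by
  rw [wordCount_congr (B := ∅) (fun l hl => by simp [h l hl])]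
  simp [wordCount]

open Classical in
theorem wordCount_zero (A : Set (List α)) : wordCount 0 A = if [] ∈ A then 1 else 0 := by
  split_ifs with h
  · unfold wordCount
    rw [Set.ncard_eq_one]
    refine ⟨[], Set.ext fun l => ?_⟩
    simp only [List.length_eq_zero_iff, Set.mem_ofPred_eq, Set.mem_singleton_iff]
    exact ⟨fun h => h.1, fun hl => ⟨hl, hl ▸ h⟩⟩
  · refine wordCount_eq_zero fun l hl => ?_
    rw [List.length_eq_zero_iff] at hl
    rwa [hl]

theorem wordCount_succ [Fintype α] (n : ℕ) (A : Set (List α)) :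
    wordCount (n + 1) A = ∑ c, wordCount n {l | c :: l ∈ A} := by
  have h : {l : List α | l.length = n + 1 ∧ l ∈ A} =
      ⋃ c, List.cons c '' {l | l.length = n ∧ c :: l ∈ A} := by
    ext l
    cases l <;> simp
  have hf : ∀ c, (List.cons c '' {l | l.length = n ∧ c :: l ∈ A}).Finite := fun c =>
    (finite_words n {l | c :: l ∈ A}).image _
  have hd : Pairwise (Function.onFun Disjoint
      fun c => List.cons c '' {l | l.length = n ∧ c :: l ∈ A}) := by
    intro c d hcd
    rw [Function.onFun, Set.disjoint_left]
    rintro _ ⟨l, _, rfl⟩ ⟨l', _, h⟩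
    exact hcd (List.cons.inj h).1.symm
  unfold wordCount
  rw [h, Set.ncard_iUnion_of_finite hf hd, finsum_eq_sum_of_fintype]
  exact Finset.sum_congr rfl fun c _ => Set.ncard_image_of_injective _ List.cons_injective

theorem wordCount_sdiff [Finite α] (n : ℕ) {A B : Set (List α)} (h : B ⊆ A) :
    (wordCount n (A \ B) : ℤ) = wordCount n A - wordCount n B := by
  have : wordCount n (A \ B) + wordCount n B = wordCount n A := by
    unfold wordCount
    rw [← Set.ncard_sdiff_add_ncard_of_subset (s := {l | l.length = n ∧ l ∈ B})
      (t := {l | l.length = n ∧ l ∈ A}) (fun l hl => ⟨hl.1, h hl.2⟩) (finite_words n A)]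
    congr 2
    ext l
    simp only [Set.mem_ofPred_eq, Set.mem_sdiff]
    tauto
  omega

end WordCount

/-! ### The shape of a witness and the graphs that it encodes -/

/-- The symbols of a witness: `(true, a, b)` carries two edge bits, `(false, true, true)` marks an
edge, `(false, true, false)` is a separator, and `(false, false, false)` is padding. -/
abbrev Sym : Type := Bool × Bool × Bool

/-- The phases of a right-to-left pass over an index in unary followed by a witness. -/
inductive Phase : Type
  | pads
  | right
  | left
  | ones
  | dead

instance : Finite Phase := by
  let f : Phase → Fin 5
    | .pads => 0
    | .right => 1
    | .left => 2
    | .ones => 3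
    | .dead => 4
  refine Finite.of_injective f ?_
  rintro (_ | _) (_ | _) h <;> simp_all [f]

namespace Phase

/-- The transition of the right-to-left pass. -/
def step : Phase → Bool ⊕ Sym → Phase
  | pads, .inr (false, false, false) => pads
  | pads, .inr (true, _, _) => right
  | right, .inr (true, _, _) => right
  | pads, .inr (false, true, true) => left
  | right, .inr (false, true, true) => left
  | left, .inr (true, _, _) => left
  | left, .inr (false, true, false) => ones
  | ones, .inl true => ones
  | _, _ => dead

/-- The output of the right-to-left pass, for the first (`y = false`) or second (`y = true`) graph,
in which the marked edge is absent (`m = false`) or present (`m = true`). To the left of the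
marked edge the two graphs agree. -/
def emit (y m : Bool) : Phase → Bool ⊕ Sym → Option Bool
  | _, .inl b => some b
  | left, .inr (true, a, _) => some a
  | _, .inr (true, a, b) => some (bif y then b else a)
  | _, .inr (false, true, true) => some m
  | _, .inr (false, true, false) => some false
  | _, .inr (false, false, _) => none

/-- The phase after a pass over a witness. -/
abbrev after (u : List Sym) : Phase := transState step pads (u.map .inr)

/-- The output of a pass over a witness. -/
abbrev bits (y m : Bool) (u : List Sym) : List Bool :=
  transOut step pads (emit y m) (u.map .inr)

theorem bits_of_pads (y m : Bool) {u : List Sym} (h : after u = pads) : bits y m u = [] := by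
  induction u with
  | nil => rfl
  | cons c u ih =>
    obtain ⟨_ | _, _ | _, _ | _⟩ := c <;>
      simp only [after, bits, List.map_cons, transState_cons, transOut_cons] at h ih ⊢ <;>
      cases hu : transState step pads (u.map Sum.inr) <;> simp_all [step, emit]

/-- Outside the padding some pair or mark has been read, and each of these emits a bit. -/
theorem bits_ne_nil (y m : Bool) {u : List Sym} (h : after u = right ∨ after u = left) :
    bits y m u ≠ [] := by
  cases u with
  | nil => rcases h with h | h <;> cases h
  | cons c u =>
    obtain ⟨_ | _, _ | _, _ | _⟩ := c <;>
      simp only [after, bits, List.map_cons, transState_cons, transOut_cons] at h ⊢ <;>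
      cases hu : transState step pads (u.map Sum.inr) <;> simp_all [step, emit]

/-- In these phases no mark has been read, and only a mark emits `m`. -/
theorem bits_mark_irrel (y m : Bool) {u : List Sym} (h : after u = pads ∨ after u = right) :
    bits y m u = bits y false u := by
  induction u with
  | nil => rfl
  | cons c u ih =>
    obtain ⟨_ | _, _ | _, _ | _⟩ := c <;>
      simp only [after, bits, List.map_cons, transState_cons, transOut_cons] at h ih ⊢ <;>
      cases hu : transState step pads (u.map Sum.inr) <;> simp_all [step, emit]

end Phase

open Phase

/-! ### Counting witnesses -/

/-- The witnesses without a mark, whose two graphs lie in `C` and `D`. -/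
def freeWitnesses (C D : Set (List Bool)) : Set (List Sym) :=
  {u | (after u = pads ∨ after u = right) ∧ bits false false u ∈ C ∧ bits true false u ∈ D}

/-- The witnesses with a mark, such that adding the marked edge to the two graphs makes them leave
`A` and `B` respectively. -/
def markedWitnesses (A B : Set (List Bool)) : Set (List Sym) :=
  {u | after u = left ∧ (bits false false u ∈ A ∧ bits false true u ∉ A) ∧
    (bits true false u ∈ B ∧ bits true true u ∉ B)}

theorem cons_mem_freeWitnesses (a b : Bool) (C D : Set (List Bool)) :
    {u | (true, a, b) :: u ∈ freeWitnesses C D} =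
      freeWitnesses {l | a :: l ∈ C} {l | b :: l ∈ D} := by
  ext u
  simp only [freeWitnesses, after, bits, Set.mem_ofPred_eq, List.map_cons, transState_cons,
    transOut_cons]
  cases hu : transState step pads (u.map Sum.inr) <;> simp [step, emit]

theorem pad_mem_freeWitnesses (C D : Set (List Bool)) (u : List Sym) :
    (false, false, false) :: u ∈ freeWitnesses C D ↔ after u = pads ∧ [] ∈ C ∧ [] ∈ D := by
  simp only [freeWitnesses, after, bits, Set.mem_ofPred_eq, List.map_cons, transState_cons,
    transOut_cons]
  cases hu : transState step pads (u.map Sum.inr) <;> simp [step, emit]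
  have h1 := bits_of_pads false false hu
  have h2 := bits_of_pads true false hu
  simp only [bits] at h1 h2
  rw [h1, h2]

theorem other_mem_freeWitnesses (C D : Set (List Bool)) (u : List Sym) {a b : Bool}
    (h : a = true ∨ b = true) : (false, a, b) :: u ∉ freeWitnesses C D := by
  simp only [freeWitnesses, after, bits, Set.mem_ofPred_eq, List.map_cons, transState_cons,
    transOut_cons]
  cases a <;> cases b <;> cases hu : transState step pads (u.map Sum.inr) <;> simp_all [step]

/-- A free witness zips a word of `C` with a word of `D` and fills up with padding on the right.
Padding cannot occur elsewhere, so the count does not depend on `m`. -/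
theorem wordCount_freeWitnesses (m n : ℕ) (hn : n ≤ m) (C D : Set (List Bool))
    (hC : ∀ l ∈ C, l.length = n) (hD : ∀ l ∈ D, l.length = n) :
    wordCount m (freeWitnesses C D) = wordCount n C * wordCount n D := by
  induction m generalizing n C D with
  | zero =>
    obtain rfl : n = 0 := by omega
    simp only [wordCount_zero]
    by_cases h1 : [] ∈ C <;> by_cases h2 : [] ∈ D <;> simp [freeWitnesses, after, bits, h1, h2]
  | succ m ih =>
    have h₀ : ∀ a b : Bool, (a = true ∨ b = true) →
        wordCount m {u | (false, a, b) :: u ∈ freeWitnesses C D} = 0 := fun a b h =>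
      wordCount_eq_zero fun u _ => other_mem_freeWitnesses C D u h
    rw [wordCount_succ]
    simp only [Fintype.sum_prod_type, Fintype.sum_bool, cons_mem_freeWitnesses, h₀, true_or,
      or_true, zero_add]
    cases n with
    | zero =>
      have hz : ∀ a b, wordCount m
          (freeWitnesses {l | a :: l ∈ C} {l | b :: l ∈ D}) = 0 := fun a b =>
        wordCount_eq_zero fun u _ h => by have := hC _ h.2.1; simp at this
      simp only [hz, zero_add]
      rw [← ih 0 (Nat.zero_le _) C D hC hD]
      refine wordCount_congr fun u _ => ?_
      rw [Set.mem_ofPred_eq, pad_mem_freeWitnesses]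
      constructor
      · rintro ⟨hu, h1, h2⟩
        exact ⟨.inl hu, by rwa [bits_of_pads _ _ hu], by rwa [bits_of_pads _ _ hu]⟩
      · rintro ⟨hu, h1, h2⟩
        have e1 := List.length_eq_zero_iff.1 (hC _ h1)
        have e2 := List.length_eq_zero_iff.1 (hD _ h2)
        rw [e1] at h1
        rw [e2] at h2
        exact ⟨hu.resolve_right fun h => bits_ne_nil _ _ (.inl h) e1, h1, h2⟩
    | succ n =>
      have hp : wordCount m {u | (false, false, false) :: u ∈ freeWitnesses C D} = 0 :=
        wordCount_eq_zero fun u _ h => by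
          have := hC _ ((pad_mem_freeWitnesses C D u).1 h).2.1
          simp at this
      have hi : ∀ a b, wordCount m (freeWitnesses {l | a :: l ∈ C} {l | b :: l ∈ D}) =
          wordCount n {l | a :: l ∈ C} * wordCount n {l | b :: l ∈ D} := fun a b =>
        ih n (by omega) _ _ (fun l hl => by simpa using hC _ hl)
          (fun l hl => by simpa using hD _ hl)
      simp only [hp, hi, wordCount_succ n, Fintype.sum_bool]
      ring

/-- A set of bit strings is down-closed: one may turn bits from `1` to `0`. -/
def DownClosed (A : Set (List Bool)) : Prop :=
  ∀ l l' : List Bool, List.Forall₂ (· ≤ ·) l l' → l' ∈ A → l ∈ A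

theorem DownClosed.cons {A : Set (List Bool)} (h : DownClosed A) (a : Bool) :
    DownClosed {l | a :: l ∈ A} :=
  fun _ _ hl hA => h _ _ (.cons le_rfl hl) hA

/-- The inclusion A₁ ⊆ A₀ lets |A₀| - |A₁| count a set; this is how the down-closed hypothesis
enters the recursion. -/
theorem DownClosed.cons_subset {A : Set (List Bool)} (h : DownClosed A) :
    {l | true :: l ∈ A} ⊆ {l | false :: l ∈ A} :=
  fun _ hA => h _ _ (.cons (Bool.false_le _) (List.forall₂_same.2 fun _ _ => le_rfl)) hA

/-- Left of the mark both graphs use `a`, while `b` is free. Summing over `b` yields the factor 2 in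
front of D(A₀, B₀) and D(A₁, B₁). -/
theorem pair_cons_mem_markedWitnesses (a b : Bool) (A B : Set (List Bool)) :
    {u | (true, a, b) :: u ∈ markedWitnesses A B} =
      markedWitnesses {l | a :: l ∈ A} {l | a :: l ∈ B} := by
  ext u
  simp only [markedWitnesses, after, bits, Set.mem_ofPred_eq, List.map_cons, transState_cons,
    transOut_cons]
  cases hu : transState step pads (u.map Sum.inr) <;> simp [step, emit]

/-- A mark at the first position contributes the product |A₀ \ A₁| |B₀ \ B₁|: the two suffixes are
independent. -/
theorem mark_cons_mem_markedWitnesses (A B : Set (List Bool)) :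
    {u | (false, true, true) :: u ∈ markedWitnesses A B} =
      freeWitnesses ({l | false :: l ∈ A} \ {l | true :: l ∈ A})
        ({l | false :: l ∈ B} \ {l | true :: l ∈ B}) := by
  ext u
  have h1 := bits_mark_irrel false true (u := u)
  have h2 := bits_mark_irrel true true (u := u)
  simp only [markedWitnesses, freeWitnesses, after, bits, Set.mem_ofPred_eq, List.map_cons,
    transState_cons, transOut_cons, Set.mem_sdiff] at h1 h2 ⊢
  cases hu : transState step pads (u.map Sum.inr) <;> simp_all [step, emit]

theorem other_mem_markedWitnesses (A B : Set (List Bool)) (u : List Sym) {a b : Bool}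
    (h : a = false ∨ b = false) : (false, a, b) :: u ∉ markedWitnesses A B := by
  simp only [markedWitnesses, after, bits, Set.mem_ofPred_eq, List.map_cons, transState_cons,
    transOut_cons]
  cases a <;> cases b <;> cases hu : transState step pads (u.map Sum.inr) <;> simp_all [step]

/-- The correlation inequality of Harris and Kleitman, with the defect counted by the marked
witnesses. -/
theorem wordCount_markedWitnesses (m n : ℕ) (hn : n ≤ m) (A B : Set (List Bool))
    (hA : DownClosed A) (hB : DownClosed B)
    (hA' : ∀ l ∈ A, l.length = n) (hB' : ∀ l ∈ B, l.length = n) :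
    (wordCount m (markedWitnesses A B) : ℤ) =
      2 ^ n * wordCount n (A ∩ B) - wordCount n A * wordCount n B := by
  induction n generalizing m A B with
  | zero =>
    -- With no positions there is nothing to mark, and the right-hand side vanishes because both
    -- sets are contained in `{[]}`.
    rw [wordCount_eq_zero fun u _ h =>
      bits_ne_nil _ _ (.inr h.1) (List.length_eq_zero_iff.1 (hA' _ h.2.1.1))]
    simp only [wordCount_zero]
    by_cases h1 : [] ∈ A <;> by_cases h2 : [] ∈ B <;> simp [h1, h2]
  | succ n ih =>
    obtain _ | m := m
    · omega
    have h₀ : ∀ a b : Bool, (a = false ∨ b = false) →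
        wordCount m {u | (false, a, b) :: u ∈ markedWitnesses A B} = 0 := fun a b h =>
      wordCount_eq_zero fun u _ => other_mem_markedWitnesses A B u h
    have hi : ∀ a, (wordCount m (markedWitnesses {l | a :: l ∈ A} {l | a :: l ∈ B}) : ℤ) =
        2 ^ n * wordCount n ({l | a :: l ∈ A} ∩ {l | a :: l ∈ B}) -
          wordCount n {l | a :: l ∈ A} * wordCount n {l | a :: l ∈ B} := fun a =>
      ih m (by omega) _ _ (hA.cons a) (hB.cons a) (fun l hl => by simpa using hA' _ hl)
        (fun l hl => by simpa using hB' _ hl)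
    have hf := wordCount_freeWitnesses m n (by omega)
      ({l | false :: l ∈ A} \ {l | true :: l ∈ A}) ({l | false :: l ∈ B} \ {l | true :: l ∈ B})
      (fun l hl => by simpa using hA' _ hl.1) (fun l hl => by simpa using hB' _ hl.1)
    have hc : ∀ a, {l | a :: l ∈ A ∩ B} = {l | a :: l ∈ A} ∩ {l | a :: l ∈ B} := fun a => rfl
    rw [wordCount_succ, wordCount_succ, wordCount_succ, wordCount_succ]
    simp only [Fintype.sum_prod_type, Fintype.sum_bool, pair_cons_mem_markedWitnesses, h₀,
      true_or, or_true, mark_cons_mem_markedWitnesses, hf, hc]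
    push_cast
    -- What remains is the recursion for D as a polynomial identity in the counts.
    rw [hi, hi, wordCount_sdiff n hA.cons_subset, wordCount_sdiff n hB.cons_subset]
    ring

/-! ### Labeled graphs as bit strings -/

/-- The pairs of vertices in the order of their adjacency bits. -/
def vertexPairs (n : ℕ) : List (Fin n × Fin n) :=
  (List.ofFn fun j : Fin n =>
    List.ofFn fun i : Fin (j : ℕ) => (Fin.castLE j.isLt.le i, j)).flatten

open Classical in
theorem edgeBits_eq_map {n : ℕ} (G : SimpleGraph (Fin n)) :
    edgeBits G = (vertexPairs n).map fun e => decide (G.Adj e.1 e.2) := by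
  simp only [edgeBits, vertexPairs, List.map_flatten, List.map_ofFn]
  congr 2
  funext j
  simp only [Function.comp, List.map_ofFn]
  congr

theorem length_vertexPairs (n : ℕ) : (vertexPairs n).length = n.choose 2 := by
  rw [vertexPairs, List.length_flatten, List.map_ofFn, List.sum_ofFn]
  simp only [Function.comp, List.length_ofFn]
  rw [Fin.sum_univ_eq_sum_range (fun i => i) n, Finset.sum_range_id, Nat.choose_two_right]

theorem mem_vertexPairs {n : ℕ} (e : Fin n × Fin n) : e ∈ vertexPairs n ↔ e.1 < e.2 := by
  simp only [vertexPairs, List.mem_flatten, List.mem_ofFn]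
  constructor
  · rintro ⟨_, ⟨j, rfl⟩, h⟩
    obtain ⟨i, rfl⟩ := List.mem_ofFn.1 h
    exact i.2
  · intro h
    exact ⟨_, ⟨e.2, rfl⟩, List.mem_ofFn.2 ⟨⟨e.1, h⟩, rfl⟩⟩

theorem nodup_vertexPairs (n : ℕ) : (vertexPairs n).Nodup := by
  rw [vertexPairs, List.nodup_flatten]
  constructor
  · intro l hl
    obtain ⟨j, rfl⟩ := List.mem_ofFn.1 hl
    rw [List.nodup_ofFn]
    intro a b h
    simpa [Fin.ext_iff] using h
  · rw [List.pairwise_ofFn]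
    intro i j hij e h1 h2
    obtain ⟨a, rfl⟩ := List.mem_ofFn.1 h1
    obtain ⟨b, hb⟩ := List.mem_ofFn.1 h2
    exact hij.ne' (congrArg Prod.snd hb)

theorem length_edgeBits {n : ℕ} (G : SimpleGraph (Fin n)) : (edgeBits G).length = n.choose 2 := by
  rw [edgeBits_eq_map, List.length_map, length_vertexPairs]

theorem le_of_forall₂_edgeBits {n : ℕ} {G H : SimpleGraph (Fin n)}
    (h : List.Forall₂ (· ≤ ·) (edgeBits H) (edgeBits G)) : H ≤ G := by
  have key : ∀ a b, a < b → H.Adj a b → G.Adj a b := by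
    rw [edgeBits_eq_map, edgeBits_eq_map, List.forall₂_map_left_iff, List.forall₂_map_right_iff,
      List.forall₂_same] at h
    intro a b hab
    simpa [Bool.le_iff_imp] using h (a, b) ((mem_vertexPairs _).2 hab)
  intro a b hab
  rcases lt_or_gt_of_ne hab.ne with h' | h'
  · exact key a b h' hab
  · exact (key b a h' hab.symm).symm

theorem edgeBits_injective (n : ℕ) :
    Function.Injective (edgeBits : SimpleGraph (Fin n) → List Bool) := fun _ _ h =>
  le_antisymm (le_of_forall₂_edgeBits (h ▸ List.forall₂_same.2 fun _ _ => le_rfl))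
    (le_of_forall₂_edgeBits (h ▸ List.forall₂_same.2 fun _ _ => le_rfl))

theorem exists_edgeBits_eq {n : ℕ} (l : List Bool) (hl : l.length = n.choose 2) :
    ∃ G : SimpleGraph (Fin n), edgeBits G = l := by
  let φ : Fin n × Fin n → Bool := fun e => l.getD ((vertexPairs n).idxOf e) false
  refine ⟨SimpleGraph.fromRel fun a b => a < b ∧ φ (a, b) = true, ?_⟩
  have h₁ : edgeBits (SimpleGraph.fromRel fun a b : Fin n => a < b ∧ φ (a, b) = true) =
      (vertexPairs n).map φ := by
    rw [edgeBits_eq_map]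
    refine List.map_congr_left fun e he => ?_
    rw [mem_vertexPairs] at he
    simp [SimpleGraph.fromRel_adj, he, he.ne, he.not_gt]
  rw [h₁]
  refine List.ext_getElem (by rw [List.length_map, length_vertexPairs, hl]) fun i hi hi' => ?_
  simp only [List.length_map] at hi
  simp only [List.getElem_map, φ, (nodup_vertexPairs n).idxOf_getElem i hi]
  exact List.getD_eq_getElem _ _ hi'

theorem unaryEncodeNat_eq (n : ℕ) : unaryEncodeNat n = List.replicate n true := by
  induction n with
  | zero => rfl
  | succ n ih => rw [unaryEncodeNat, ih, List.replicate_succ]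

theorem unary_append_inj {m n : ℕ} {l l' : List Bool}
    (h : unaryEncodeNat m ++ false :: l = unaryEncodeNat n ++ false :: l') : m = n ∧ l = l' := by
  induction m generalizing n with
  | zero => cases n <;> simp_all [unaryEncodeNat]
  | succ m ih =>
    cases n with
    | zero => simp [unaryEncodeNat] at h
    | succ n =>
      simp only [unaryEncodeNat, List.cons_append, List.cons.injEq, true_and] at h
      simpa using ih h

/-- The sets of adjacency bits of the graphs on `n` vertices in a family. -/
def bitSet (A : GraphFamily) (n : ℕ) : Set (List Bool) := edgeBits '' A n

theorem unary_append_mem_membershipProblem (A : GraphFamily) (n : ℕ) (l : List Bool) :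
    unaryEncodeNat n ++ false :: l ∈ membershipProblem A ↔ l ∈ bitSet A n := by
  constructor
  · rintro ⟨m, G, hG, h⟩
    obtain ⟨rfl, rfl⟩ := unary_append_inj h
    exact ⟨G, hG, rfl⟩
  · rintro ⟨G, hG, rfl⟩
    exact ⟨n, G, hG, rfl⟩

/-- Membership itself forces the right number of bits, so the automaton never has to compare the
witness with `n`. -/
theorem length_of_mem_bitSet {A : GraphFamily} {n : ℕ} {l : List Bool} (h : l ∈ bitSet A n) :
    l.length = n.choose 2 := by
  obtain ⟨G, _, rfl⟩ := h
  exact length_edgeBits G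

theorem IsHereditary.downClosed {A : GraphFamily} (hA : IsHereditary A) (n : ℕ) :
    DownClosed (bitSet A n) := by
  rintro l _ h ⟨G, hG, rfl⟩
  obtain ⟨H, rfl⟩ := exists_edgeBits_eq (n := n) l (h.length_eq.trans (length_edgeBits G))
  exact ⟨H, hA n G H hG (le_of_forall₂_edgeBits h), rfl⟩

theorem wordCount_image_edgeBits {n : ℕ} (A : Set (SimpleGraph (Fin n))) :
    wordCount (n.choose 2) (edgeBits '' A) = A.ncard := by
  rw [← Set.ncard_image_of_injective A (edgeBits_injective n), wordCount]
  congr 1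
  ext l
  refine ⟨fun h => h.2, fun h => ⟨?_, h⟩⟩
  obtain ⟨G, _, rfl⟩ := h
  exact length_edgeBits G

/-! ### The verifier -/

theorem transState_index_eq_ones (x : List Bool) (v : List (Bool ⊕ Sym)) :
    transState step pads (x.map .inl ++ v) = ones ↔
      (∀ b ∈ x, b = true) ∧ transState step pads v = ones := by
  induction x with
  | nil => simp
  | cons b x ih =>
    rw [List.forall_mem_cons, and_assoc, ← ih, List.map_cons, List.cons_append, transState_cons]
    cases b <;> cases transState step pads (x.map Sum.inl ++ v) <;> simp [step]

theorem transOut_index (y m : Bool) (x : List Bool) (v : List (Bool ⊕ Sym)) :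
    transOut step pads (emit y m) (x.map .inl ++ v) = x ++ transOut step pads (emit y m) v := by
  induction x with
  | nil => rfl
  | cons b x ih =>
    rw [List.map_cons, List.cons_append, transOut_cons, ih]
    simp [emit]

/-- The leading symbol must be the separator, whose output is the `0` between the unary index and
the adjacency bits in `encodeGraph`. -/
theorem after_cons_eq_ones (c : Sym) (u : List Sym) :
    after (c :: u) = ones ↔ c = (false, true, false) ∧ after u = left := by
  simp only [after, List.map_cons, transState_cons]
  obtain ⟨_ | _, _ | _, _ | _⟩ := c <;>
    cases transState step pads (u.map Sum.inr) <;> simp [step]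

/-- The words `v` consisting of an index in unary and a witness, such that the first (`y = false`)
or second (`y = true`) graph is in the language `L`, but not after adding the marked edge. -/
def passLanguage (L : Set (List Bool)) (y : Bool) : Set (List (Bool ⊕ Sym)) :=
  {v | transState step pads v = ones ∧
    ∀ m, transOut step pads (emit y m) v ∈ L ↔ m = false}

theorem polyTimeDecidable_passLanguage {L : Set (List Bool)}
    (hL : PolyTimeDecidable (fun x : List Bool => x) L) (y : Bool) :
    PolyTimeDecidable (fun v : List (Bool ⊕ Sym) => v) (passLanguage L y) :=
  PolyTimeDecidable.transduce (fun _ => hL) step pads (emit y) (· = ones) (· = false)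

/-- A witness as a bit string. -/
def unblock : List Sym → List Bool
  | [] => []
  | (a, b, c) :: u => a :: b :: c :: unblock u

theorem length_unblock (u : List Sym) : (unblock u).length = 3 * u.length := by
  induction u with
  | nil => rfl
  | cons c u ih => simp only [unblock, List.length_cons, ih]; ring

theorem unblock_injective : Function.Injective unblock := by
  intro u v h
  induction u generalizing v with
  | nil => cases v <;> simp_all [unblock]
  | cons c u ih =>
    cases v with
    | nil => simp [unblock] at h
    | cons d v =>
      simp only [unblock, List.cons.injEq] at h
      rw [ih h.2.2.2, Prod.ext h.1 (Prod.ext h.2.1 h.2.2.1)]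

theorem exists_unblock_eq (n : ℕ) (w : List Bool) (hw : w.length = 3 * n) :
    ∃ u, u.length = n ∧ unblock u = w := by
  induction n generalizing w with
  | zero => exact ⟨[], rfl, (List.length_eq_zero_iff.1 hw).symm⟩
  | succ n ih =>
    match w with
    | a :: b :: c :: w =>
      obtain ⟨u, hu, rfl⟩ := ih w (by simp only [List.length_cons] at hw; omega)
      exact ⟨(a, b, c) :: u, by simp [hu], rfl⟩
    | [] | [_] | [_, _] => simp only [List.length_cons, List.length_nil] at hw; omega

/-- The transition of the transducer that groups the bits of the second word of a pair by threes:
the state holds the bits of the incomplete group, the latest bit first. -/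
def blockStep : Option (Bool × Option Bool) → Bool ⊕ Bool → Option (Bool × Option Bool)
  | s, .inl _ => s
  | none, .inr b => some (b, none)
  | some (c, none), .inr b => some (b, some c)
  | some (_, some _), .inr _ => none

/-- The output of the transducer that groups the bits of the second word of a pair by threes. -/
def blockEmit : Option (Bool × Option Bool) → Bool ⊕ Bool → Option (Bool ⊕ Sym)
  | _, .inl a => some (.inl a)
  | some (b, some c), .inr a => some (.inr (a, b, c))
  | _, .inr _ => none

theorem transState_unblock (u : List Sym) :
    transState blockStep none ((unblock u).map .inr) = none := by
  induction u with
  | nil => rfl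
  | cons c u ih => simp [unblock, ih, blockStep]

theorem transOut_unblock (u : List Sym) :
    transOut blockStep none blockEmit ((unblock u).map .inr) = u.map .inr := by
  induction u with
  | nil => rfl
  | cons c u ih => simp [unblock, ih, blockStep, blockEmit, transState_unblock]

/-- Grouping from the right agrees with grouping from the left, since `unblock u` has length
divisible by 3. -/
theorem transOut_encodePair_unblock (x : List Bool) (u : List Sym) :
    transOut blockStep none blockEmit (encodePair (x, unblock u)) =
      x.map .inl ++ u.map .inr := by
  change transOut blockStep none blockEmit (x.map .inl ++ (unblock u).map .inr) = _
  induction x with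
  | nil => exact transOut_unblock u
  | cons a x ih =>
    rw [List.map_cons, List.cons_append, transOut_cons, ih]
    simp [blockEmit]

/-- The pairs of an index in unary and a witness for the defect of the correlation inequality. -/
def verifier (L : Bool → Set (List Bool)) : Set (List Bool × List Bool) :=
  {p | True ∧ ∀ y, transOut blockStep none blockEmit (encodePair p) ∈ passLanguage (L y) y ↔ True}

theorem polyTimeDecidable_verifier {L : Bool → Set (List Bool)}
    (hL : ∀ y, PolyTimeDecidable (fun x : List Bool => x) (L y)) :
    PolyTimeDecidable encodePair (verifier L) :=
  PolyTimeDecidable.transduce (fun y => polyTimeDecidable_passLanguage (hL y) y) blockStep none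
    (fun _ => blockEmit) (fun _ => True) (fun _ => True)

theorem forall_eq_true_of_mem_verifier {L : Bool → Set (List Bool)} {x : List Bool} {u : List Sym}
    (h : (x, unblock u) ∈ verifier L) : ∀ b ∈ x, b = true := by
  have := (h.2 true).2 trivial
  rw [transOut_encodePair_unblock] at this
  exact ((transState_index_eq_ones x _).1 this.1).1

theorem cons_mem_verifier (A : Bool → GraphFamily) (n : ℕ) (c : Sym) (u : List Sym) :
    (unaryEncodeNat n, unblock (c :: u)) ∈ verifier (fun y => {x | x ∈ membershipProblem (A y)}) ↔
      c = (false, true, false) ∧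
        u ∈ markedWitnesses (bitSet (A false) n) (bitSet (A true) n) := by
  have hx : ∀ b ∈ unaryEncodeNat n, b = true := by
    rw [unaryEncodeNat_eq]
    exact fun b hb => (List.mem_replicate.1 hb).2
  have hb : c = (false, true, false) → ∀ y m,
      transOut step pads (emit y m) ((c :: u).map .inr) = false :: bits y m u := by
    rintro rfl y m
    simp [emit, bits]
  have hs := after_cons_eq_ones c u
  simp only [verifier, Set.mem_ofPred_eq, transOut_encodePair_unblock, passLanguage,
    transState_index_eq_ones, transOut_index, true_and, iff_true, hs]
  by_cases hc : c = (false, true, false)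
  · subst hc
    simp only [hb rfl, unary_append_mem_membershipProblem, markedWitnesses, Set.mem_ofPred_eq,
      iff_true_intro hx, true_and]
    simp only [Bool.forall_bool, iff_true, reduceCtorEq, iff_false]
    tauto
  · simp [hc]

theorem ncard_verifier (L : Bool → Set (List Bool)) (x : List Bool) (n : ℕ) :
    {w : List Bool | w.length = 3 * n ∧ (x, w) ∈ verifier L}.ncard =
      wordCount n {u | (x, unblock u) ∈ verifier L} := by
  rw [wordCount, ← Set.ncard_image_of_injective _ unblock_injective]
  congr 1
  ext w
  constructor
  · rintro ⟨hw, h⟩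
    obtain ⟨u, hu, rfl⟩ := exists_unblock_eq n w hw
    exact ⟨u, ⟨hu, h⟩, rfl⟩
  · rintro ⟨u, ⟨hu, h⟩, rfl⟩
    exact ⟨by rw [length_unblock, hu], h⟩

theorem wordCount_verifier (A : Bool → GraphFamily) (n m : ℕ) :
    wordCount (m + 1) {u | (unaryEncodeNat n, unblock u) ∈
        verifier (fun y => {x | x ∈ membershipProblem (A y)})} =
      wordCount m (markedWitnesses (bitSet (A false) n) (bitSet (A true) n)) := by
  rw [wordCount_succ, Fintype.sum_eq_single (false, true, false)]
  · exact wordCount_congr fun u _ => (cons_mem_verifier A n _ u).trans (and_iff_right rfl)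
  · exact fun c hc => wordCount_eq_zero fun u _ h => hc ((cons_mem_verifier A n c u).1 h).1


theorem defect_mem_sharpP (A : Bool → GraphFamily)
    (hA : ∀ y, membershipProblem (A y) ∈ ClassP) :
    SequenceInSharpP fun n =>
      wordCount (n ^ 2) (markedWitnesses (bitSet (A false) n) (bitSet (A true) n)) := by
  -- Three bits per symbol, one separator, and `n ^ 2` symbols for the edge positions and padding.
  refine ⟨3 * (Polynomial.X ^ 2 + 1), verifier fun y => {x | x ∈ membershipProblem (A y)},
    polyTimeDecidable_verifier hA, fun x => ?_⟩
  have hq : (3 * (Polynomial.X ^ 2 + 1) : Polynomial ℕ).eval x.length =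
      3 * (x.length ^ 2 + 1) := by simp
  rw [hq, ncard_verifier]
  have hinj : Function.Injective Computability.unaryEncodeNat :=
    Function.LeftInverse.injective Computability.unary_decode_encode_nat
  by_cases hx : ∃ n, Computability.unaryEncodeNat n = x
  · obtain ⟨n, rfl⟩ := hx
    have hn : (Computability.unaryEncodeNat n).length = n :=
      Computability.unary_decode_encode_nat n
    rw [hinj.extend_apply, hn, wordCount_verifier]
  · rw [Function.extend_apply' _ _ _ hx, Pi.zero_apply]
    -- An accepted index consists of ones only, hence is the unary code of its length.
    refine (wordCount_eq_zero fun u _ h => hx ⟨x.length, ?_⟩).symm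
    rw [unaryEncodeNat_eq]
    exact (List.eq_replicate_iff.2 ⟨rfl, forall_eq_true_of_mem_verifier h⟩).symm

end CountingComplexity

theorem mainTheorem6 (A B : CountingComplexity.GraphFamily)
    (hA : CountingComplexity.IsHereditary A) (hB : CountingComplexity.IsHereditary B)
    (hAP : CountingComplexity.membershipProblem A ∈ CountingComplexity.ClassP)
    (hBP : CountingComplexity.membershipProblem B ∈ CountingComplexity.ClassP) :
    ∃ f : ℕ → ℕ,
      (∀ n : ℕ, (f n : ℤ) =
        2 ^ (n.choose 2) * ((A n ∩ B n).ncard : ℤ) - ((A n).ncard : ℤ) * ((B n).ncard : ℤ)) ∧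
      CountingComplexity.SequenceInSharpP f := by
  refine ⟨_, fun n => ?_, CountingComplexity.defect_mem_sharpP (fun y => bif y then B else A)
    (Bool.forall_bool.2 ⟨hAP, hBP⟩)⟩
  simp only [cond_true, cond_false]
  -- The bound `n.choose 2 ≤ n ^ 2` leaves room for all edge positions; padding absorbs the
  -- difference.
  rw [CountingComplexity.wordCount_markedWitnesses (n ^ 2) (n.choose 2) (Nat.choose_le_pow n 2) _ _
    (hA.downClosed n) (hB.downClosed n) (fun _ => CountingComplexity.length_of_mem_bitSet)
    (fun _ => CountingComplexity.length_of_mem_bitSet)]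
  simp only [CountingComplexity.bitSet,
    ← Set.image_inter (CountingComplexity.edgeBits_injective n),
    CountingComplexity.wordCount_image_edgeBits]
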